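/- Let $V$ be an $n$-dimensional real inner product space and let $E\subset V$ be a finite set of unit vectors such that $E\cap(-E)=\varnothing$ and such that some $t\in V$ satisfies $(e,t)>0$ for all $e\in E$. Let $\mathcal H=\{H_e : e\in E\}$, $H_e=e^\perp$, be the corresponding central hyperplane arrangement, and let its base chamber be $T_0=\{x : (e,x)>0 \text{ for all } e\in E\}$. The sign of a chamber of $\mathcal H$ is $-1$ to the number of hyperplanes of $\mathcal H$ that separate it from $T_0$. *Even arrangements.* If $\mathcal A$ is a finite set of hyperplanes of a subspace $L$ and $M\in\mathcal A$, the even restricted arrangement $\mathcal A_M$ in $M$ consists of the subspaces $M\cap N$, $N\in\mathcal A$, $N\neq M$, that are contained in an even number of elements of $\mathcal A$. Write $H_{e_1,\dots,e_i}=H_{e_1}\cap\dots\cap H_{e_i}$. A sequence $(e_1,\dots,e_r)\in E^r$ is an even restriction sequence if, starting from $\mathcal H_\varnothing=\mathcal H$ in $V$, for each $i=1,\dots,r$ one has $H_{e_1,\dots,e_i}\in\mathcal H_{e_1,\dots,e_{i-1}}$, where $\mathcal H_{e_1,\dots,e_i}:=(\mathcal H_{e_1,\dots,e_{i-1}})_{H_{e_1,\dots,e_i}}$.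 Let $P_r$ be the set of these sequences, and let $(e_1,\dots,e_r)\sim(f_1,\dots,f_r)$ if $H_{e_1,\dots,e_i}=H_{f_1,\dots,f_i}$ for all $i\le r$. The arrangement $\mathcal H$ is even if, for every $r\ge 0$ and every $(e_1,\dots,e_r)\in P_r$, the arrangement $\mathcal H_{e_1,\dots,e_r}$ is essential in $H_{e_1,\dots,e_r}$ (its hyperplanes meet only in $0$; the intersection of an empty family is $H_{e_1,\dots,e_r}$). *The polynomial.* For $(e_1,\dots,e_n)\in P_n$ let $\pi_{e_1,\dots,e_{i-1}}$ be the orthogonal projection onto $H_{e_1,\dots,e_{i-1}}$ and let $\nu_i=\pi_{e_1,\dots,e_{i-1}}(e_i)/\|\pi_{e_1,\dots,e_{i-1}}(e_i)\|$, the unit normal vector of $H_{e_1,\dots,e_i}$ in $H_{e_1,\dots,e_{i-1}}$ on the side of $e_i$. Let $(-1)^{e_n\circ\cdots\circ e_1}$ be the sign of the chamber of $\mathcal H$ that contains $\varepsilon\nu_n+\varepsilon^2\nu_{n-1}+\dots+\varepsilon^n\nu_1$ for all small $\varepsilon>0$. For $\mathcal H$ even, put $$f_{\mathcal H}(a)=\frac{2^n}{n!}\sum_{(e_1,\dots,e_n)\in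 P_n/\sim}(-1)^{e_n\circ\cdots\circ e_1}\,(a,\nu_1)\,(\pi_{e_1}(a),\nu_2)\cdots(\pi_{e_1,\dots,e_{n-1}}(a),\nu_n),\qquad a\in V;$$ each summand depends only on the equivalence class. *Coxeter arrangements.* $\mathcal H$ is a Coxeter arrangement if the group generated by the orthogonal reflections in its hyperplanes (its Coxeter group) is finite and $\mathcal H$ is stable under these reflections. It is of type $A_1^n$ if $E$ is an orthonormal basis of $V$. **Proposition.** Suppose that $\mathcal H$ is even. If $\mathcal H$ is a Coxeter arrangement, then for all $a\in V$ $$f_{\mathcal H}(a)=\begin{cases}2^n\prod_{e\in E}(a,e)&\text{if }\mathcal H\text{ is of type }A_1^n,\\ 0&\text{otherwise.}\end{cases}$$ More generally, let $E'\subseteq E$ be such that $\mathcal H'=\{H_e : e\in E'\}$ is a Coxeter arrangement whose Coxeter group preserves $\mathcal H$ (each of its elements maps hyperplanes of $\mathcal H$ to hyperplanes of $\mathcal H$). Then (i) if $\mathcal H'$ has at least $n+1$ hyperplanes, then $f_{\mathcal H}=0$; (ii) if $\mathcal H'$ has exactly $n$ hyperplanes, then there is a constant $c\in\mathbb R$ with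 $f_{\mathcal H}(a)=c\prod_{e\in E'}(a,e)$ for all $a\in V$. -/

import Mathlib

namespace PizzaArrangement

open scoped InnerProductSpace

noncomputable section

variable {V : Type*} [NormedAddCommGroup V] [InnerProductSpace ℝ V]

/-- `E` is the set of unit normal vectors of a finite central hyperplane arrangement, oriented
so that there is a base chamber on which all the vectors of `E` are positive. -/
structure IsArrangement (E : Finset V) : Prop where
  norm_eq_one : ∀ e ∈ E, ‖e‖ = 1
  neg_notMem : ∀ e ∈ E, -e ∉ E
  exists_base : ∃ t : V, ∀ e ∈ E, 0 < ⟪e, t⟫_ℝ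

/-- The hyperplane `H_e`, the orthogonal complement of `e`. -/
def hyp (e : V) : Submodule ℝ V := (ℝ ∙ e)ᗮ

/-- The set of hyperplanes of the arrangement given by `E`. -/
def hyperplanes (E : Finset V) : Set (Submodule ℝ V) := {H | ∃ e ∈ E, H = hyp e}

/-- The isometry `w` maps hyperplanes of the arrangement to hyperplanes of the arrangement. -/
def Preserves (w : V ≃ₗᵢ[ℝ] V) (E : Finset V) : Prop :=
  ∀ H ∈ hyperplanes E, H.map (w.toLinearEquiv : V →ₗ[ℝ] V) ∈ hyperplanes E

section Restriction

/-- The even restricted arrangement on `M`. Here `A` is a set of hyperplanes of a subspace `L` of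
`V`, and `M` is one of them. The members of the result are the `M ⊓ N` for the `N ∈ A` other than
`M` such that an even number of elements of `A` contain `M ⊓ N`. -/
def evenRestricted (A : Set (Submodule ℝ V)) (M : Submodule ℝ V) : Set (Submodule ℝ V) :=
  {X | ∃ N ∈ A, N ≠ M ∧ Even {K ∈ A | M ⊓ N ≤ K}.ncard ∧ X = M ⊓ N}

/-- `seqSpace e i` is the intersection of the hyperplanes of the first `i` entries of `e`. -/
def seqSpace {E : Finset V} {r : ℕ} (e : Fin r → E) (i : ℕ) : Submodule ℝ V :=
  ⨅ j : Fin r, ⨅ _ : (j : ℕ) < i, hyp (e j : V)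

/-- `seqArr e i` is the iterated even restricted arrangement in `seqSpace e i` that is obtained
from the first `i` entries of `e`. -/
def seqArr {E : Finset V} {r : ℕ} (e : Fin r → E) : ℕ → Set (Submodule ℝ V)
  | 0 => hyperplanes E
  | i + 1 => evenRestricted (seqArr e i) (seqSpace e (i + 1))

/-- `e` is an even restriction sequence of length `r`. -/
def IsEvenSeq {E : Finset V} {r : ℕ} (e : Fin r → E) : Prop :=
  ∀ i : Fin r, seqSpace e ((i : ℕ) + 1) ∈ seqArr e (i : ℕ)

/-- The arrangement is even: for every even restriction sequence, the associated arrangement is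
essential in the subspace in which it lives, i.e. its hyperplanes meet only at the origin. -/
def IsEven (E : Finset V) : Prop :=
  ∀ (r : ℕ) (e : Fin r → E), IsEvenSeq e → seqSpace e r ⊓ sInf (seqArr e r) = ⊥

/-- The set of even restriction sequences of length `r`. -/
abbrev EvenSeq (E : Finset V) (r : ℕ) : Type _ := {e : Fin r → E // IsEvenSeq e}

/-- Two even restriction sequences are equivalent if they give the same flag of subspaces. -/
def evenSeqSetoid (E : Finset V) (r : ℕ) : Setoid (EvenSeq E r) where
  r e f := ∀ i ≤ r, seqSpace e.1 i = seqSpace f.1 i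
  iseqv :=
    { refl := fun _ _ _ => rfl
      symm := fun h i hi => (h i hi).symm
      trans := fun h k i hi => (h i hi).trans (k i hi) }

end Restriction

/-- Composition of a face, given by its sign vector `X`, with a vector `v`: the sign vector of
`x + ε v` for `x` in the face and `ε > 0` small. -/
def compSign (X : V → SignType) (v : V) : V → SignType :=
  fun e => if X e = 0 then SignType.sign ⟪e, v⟫_ℝ else X e

/-- The sign vector of the face `{0} ∘ v_{r-1} ∘ ... ∘ v_0`, the one that contains
`ε v_{r-1} + ε² v_{r-2} + ... + ε^r v_0` for `ε > 0` small. -/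
def flagSign {r : ℕ} (v : Fin r → V) : V → SignType :=
  (List.ofFn v).foldr (fun w X => compSign X w) (fun _ => 0)

open Classical in
/-- `-1` to the number of hyperplanes that separate the base chamber from the chamber with sign
vector `X`. -/
def chamberSign (E : Finset V) (X : V → SignType) : ℝ :=
  (-1) ^ (E.filter fun e => X e = -1).card

section FiniteDimensional

variable [FiniteDimensional ℝ V]

/-- The unit normal vector of the subspace cut out by the first `i + 1` entries of `e`, inside the
subspace cut out by the first `i` entries, that lies on the same side as the entry of index `i`:
the normalized orthogonal projection of this entry. -/
def unitNormal {E : Finset V} {r : ℕ} (e : Fin r → E) (i : Fin r) : V :=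
  ‖(seqSpace e i).starProjection (e i : V)‖⁻¹ • (seqSpace e i).starProjection (e i : V)

/-- The contribution of an even restriction sequence to the polynomial of the arrangement. It
depends only on the equivalence class of the sequence, as changing the orientation of one of the
unit normal vectors changes both the sign and the product by the factor `-1`. -/
def seqTerm {E : Finset V} {r : ℕ} (e : Fin r → E) (a : V) : ℝ :=
  chamberSign E (flagSign (unitNormal e)) *
    ∏ i : Fin r, ⟪(seqSpace e i).starProjection a, unitNormal e i⟫_ℝ

open Classical in
/-- The polynomial function `f` of the (even) arrangement: `2 ^ n / n!` times the sum of the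
contributions of the equivalence classes of even restriction sequences of length `n = dim V`. -/
def pizzaPoly (E : Finset V) (a : V) : ℝ :=
  2 ^ Module.finrank ℝ V / (Nat.factorial (Module.finrank ℝ V) : ℝ) *
    ∑ c : Quotient (evenSeqSetoid E (Module.finrank ℝ V)), seqTerm (Quotient.out c).1 a

/-- The group generated by the orthogonal reflections in the hyperplanes of the arrangement. -/
def coxeterGroup (E : Finset V) : Subgroup (V ≃ₗᵢ[ℝ] V) :=
  Subgroup.closure {s | ∃ H ∈ hyperplanes E, s = H.reflection}

/-- Coxeter arrangements. -/
structure IsCoxeter (E : Finset V) : Prop where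
  finite : Finite (coxeterGroup E)
  reflection_preserves : ∀ H ∈ hyperplanes E, Preserves H.reflection E

/-- The arrangement is of type `A_1^n`, where `n` is the dimension of the space: the product of `n`
copies of the one-dimensional arrangement `{0}`. -/
def IsTypeA1 (E : Finset V) : Prop :=
  ∃ b : OrthonormalBasis (Fin (Module.finrank ℝ V)) ℝ V, (E : Set V) = Set.range b

end FiniteDimensional

end

end PizzaArrangement

/-! Let `n` be the dimension of `V`. The polynomial is a sum of products of `n` linear forms, and it
changes sign under every reflection that preserves the arrangement. So it vanishes on the mirrors,
and its degree leaves little room.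

Let `s` be the reflection in `H_h`, with `h ∈ E`, and suppose that it preserves the arrangement.
Even restriction is expressed through intersections and inclusions alone, so `s` permutes the
classes of even restriction sequences. It carries unit normals of a flag to unit normals of the
image flag and reverses the sign of the chamber (`IsFrame.chamberSign_reflection`). If `a ∈ H_h`,
then `(a, s v) = (a, v)`, so the sum equals its own negative (`pizzaPoly_eq_zero_of_mem_hyp`). The
normals chosen for the image flag may differ from the images of the normals by signs. This is
harmless because an odd number of hyperplanes contain one member of an even flag but not the
preceding one (`IsEvenSeq.odd_card`, `IsFrame.flagTerm_eq`).

A form of degree `n` that vanishes on `n + 1` hyperplanes is zero, and one that vanishes on `n` of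
them is a multiple of the product of their equations. `sum_prod_inner_eq_of_vanishing` proves this
on lines in the direction of a base vector, where only polynomials in one variable are needed. This
gives (i) and (ii).

In the Coxeter case, essentiality makes `E` span `V`, so `E` has at least `n` members. With exactly
`n` it is a basis, and stability under reflections makes it orthonormal (`isTypeA1_of_card_eq`);
otherwise (i) applies. For an orthonormal basis there are `n!` classes, each contributing the
product of the coordinates. -/

namespace PizzaArrangement

open scoped InnerProductSpace

noncomputable section

variable {V : Type*} [NormedAddCommGroup V] [InnerProductSpace ℝ V]

/-! ### Hyperplanes and their unit normals -/

theorem mem_hyp {e x : V} : x ∈ hyp e ↔ ⟪e, x⟫_ℝ = 0 :=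
  Submodule.mem_orthogonal_singleton_iff_inner_right

theorem hyp_covBy_top {e : V} (he : e ≠ 0) : hyp e ⋖ ⊤ := by
  rw [covBy_top_iff]
  have h : hyp e = LinearMap.ker (innerₗ V e) := by
    ext x
    simp [mem_hyp]
  rw [h]
  refine LinearMap.isCoatom_ker_of_surjective ?_
  refine LinearMap.surjective fun h0 => he ?_
  have := LinearMap.congr_fun h0 e
  simpa using this

theorem eq_or_eq_neg_of_hyp_eq {e f : V} (he : ‖e‖ = 1) (hf : ‖f‖ = 1) (h : hyp e = hyp f) :
    e = f ∨ e = -f := by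
  have hs : (ℝ ∙ e) = ℝ ∙ f := by
    have := congrArg Submodule.orthogonal h
    simpa [hyp] using this
  obtain ⟨c, hc⟩ := Submodule.mem_span_singleton.1 (hs ▸ Submodule.mem_span_singleton_self e)
  have hc1 : |c| = 1 := by
    have := congrArg norm hc
    rwa [norm_smul, he, hf, mul_one, Real.norm_eq_abs] at this
  rcases eq_or_eq_neg_of_abs_eq hc1 with rfl | rfl
  · left; simpa using hc.symm
  · right; simpa using hc.symm

theorem IsArrangement.ne_zero {E : Finset V} (hE : IsArrangement E) {e : V} (he : e ∈ E) :
    e ≠ 0 := by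
  rintro rfl
  simpa using hE.norm_eq_one 0 he

theorem IsArrangement.hyp_injOn {E : Finset V} (hE : IsArrangement E) :
    Set.InjOn (hyp : V → Submodule ℝ V) E := by
  intro e he f hf h
  rcases eq_or_eq_neg_of_hyp_eq (hE.norm_eq_one e he) (hE.norm_eq_one f hf) h with h | h
  · exact h
  · exact absurd (h ▸ he) (hE.neg_notMem f hf)

theorem hyperplanes_eq_image (E : Finset V) : hyperplanes E = hyp '' (E : Set V) := by
  ext H
  simp [hyperplanes, eq_comm]

theorem finite_hyperplanes (E : Finset V) : (hyperplanes E).Finite := by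
  rw [hyperplanes_eq_image]
  exact E.finite_toSet.image _

/-! ### Even restriction and parity -/

theorem evenRestricted_subset_image (A : Set (Submodule ℝ V)) (M : Submodule ℝ V) :
    evenRestricted A M ⊆ (M ⊓ ·) '' A := by
  rintro X ⟨N, hN, -, -, rfl⟩
  exact ⟨N, hN, rfl⟩

theorem finite_evenRestricted {A : Set (Submodule ℝ V)} (hA : A.Finite) (M : Submodule ℝ V) :
    (evenRestricted A M).Finite :=
  (hA.image _).subset (evenRestricted_subset_image A M)

theorem inf_covBy_of_covBy {L M N : Submodule ℝ V} (hM : M ⋖ L) (hN : N ⋖ L) (h : N ≠ M) :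
    M ⊓ N ⋖ M := by
  have hsup : M ⊔ N = L := by
    refine (hM.eq_or_eq le_sup_left (sup_le hM.le hN.le)).resolve_left fun h1 => ?_
    have hle : N ≤ M := sup_eq_left.1 h1
    exact h ((hN.eq_or_eq hle hM.le).resolve_right hM.ne).symm
  exact inf_covBy_of_covBy_sup_of_covBy_sup_left (hsup ▸ hM) (hsup ▸ hN)

theorem evenRestricted_covBy {A : Set (Submodule ℝ V)} {L M : Submodule ℝ V}
    (hA : ∀ K ∈ A, K ⋖ L) (hM : M ∈ A) : ∀ X ∈ evenRestricted A M, X ⋖ M := by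
  rintro X ⟨N, hN, hne, -, rfl⟩
  exact inf_covBy_of_covBy (hA M hM) (hA N hN) hne

open Classical in
/-- Passing to the even restricted arrangement changes the parity of the number of members that
contain a given subspace. -/
theorem even_ncard_add_ncard_evenRestricted_add_one {A : Set (Submodule ℝ V)} (hfin : A.Finite)
    {L M X : Submodule ℝ V} (hA : ∀ K ∈ A, K ⋖ L) (hM : M ∈ A) (hX : X ≤ M) :
    Even ({K ∈ A | X ≤ K}.ncard + {Y ∈ evenRestricted A M | X ≤ Y}.ncard + 1) := by
  set B : Finset (Submodule ℝ V) := hfin.toFinset with hB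
  have memB : ∀ K, K ∈ B ↔ K ∈ A := fun K => by simp [hB]
  -- The members through `X` other than `M`, to be sorted by their traces `M ⊓ N`.
  set S : Finset (Submodule ℝ V) := {K ∈ B | X ≤ K ∧ K ≠ M} with hS
  have hcard : {K ∈ A | X ≤ K}.ncard = S.card + 1 := by
    have h1 : {K ∈ A | X ≤ K} = ((insert M S : Finset (Submodule ℝ V)) : Set (Submodule ℝ V)) := by
      ext K
      simp only [Set.mem_ofPred_eq, Finset.coe_insert, Set.mem_insert_iff, hS, Finset.coe_filter,
        memB]
      by_cases h : K = M <;> simp [h, hM, hX]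
    rw [h1, Set.ncard_coe_finset, Finset.card_insert_of_notMem (by simp [hS])]
  -- Two hyperplanes of `M` are equal once one contains the other, so the members above `M ⊓ N` are
  -- `M` and those with this same trace.
  have hfib : ∀ N ∈ S, {K ∈ A | M ⊓ N ≤ K}.ncard = {K ∈ S | M ⊓ K = M ⊓ N}.card + 1 := by
    intro N hN
    simp only [hS, Finset.mem_filter, memB] at hN
    have h1 : {K ∈ A | M ⊓ N ≤ K} =
        ((insert M {K ∈ S | M ⊓ K = M ⊓ N} : Finset (Submodule ℝ V)) : Set (Submodule ℝ V)) := by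
      ext K
      simp only [Set.mem_ofPred_eq, Finset.coe_insert, Set.mem_insert_iff, hS, Finset.coe_filter,
        memB, Finset.mem_filter]
      by_cases h : K = M
      · simp [h, hM]
      · simp only [h, false_or, not_false_eq_true, and_true, ne_eq]
        constructor
        · rintro ⟨hK, hle⟩
          refine ⟨⟨hK, (le_inf hX hN.2.1).trans hle⟩, ?_⟩
          have hc := inf_covBy_of_covBy (hA M hM) (hA N hN.1) hN.2.2
          have hc' := inf_covBy_of_covBy (hA M hM) (hA K hK) h
          exact ((hc.eq_or_eq (le_inf inf_le_left hle) hc'.le).resolve_right hc'.ne)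
        · rintro ⟨⟨hK, -⟩, h2⟩
          exact ⟨hK, h2 ▸ inf_le_right⟩
    rw [h1, Set.ncard_coe_finset, Finset.card_insert_of_notMem (by simp [hS])]
  -- Since `M` is counted too, a trace survives exactly when its fibre in `S` is odd. The number of
  -- odd fibres has the parity of `S`.
  have hrestr : {Y ∈ evenRestricted A M | X ≤ Y} =
      (({Y ∈ S.image (M ⊓ ·) | Odd ({K ∈ S | M ⊓ K = Y}.card)} : Finset (Submodule ℝ V)) :
        Set (Submodule ℝ V)) := by
    ext Y
    simp only [Set.mem_ofPred_eq, Finset.coe_filter, Finset.mem_image]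
    constructor
    · rintro ⟨⟨N, hN, hne, hev, rfl⟩, hle⟩
      have hNS : N ∈ S := by
        simp only [hS, Finset.mem_filter, memB]
        exact ⟨hN, hle.trans inf_le_right, hne⟩
      refine ⟨⟨N, hNS, rfl⟩, ?_⟩
      rw [hfib N hNS] at hev
      simpa [Nat.even_add_one] using hev
    · rintro ⟨⟨N, hNS, rfl⟩, hodd⟩
      have hN := hNS
      simp only [hS, Finset.mem_filter, memB] at hN
      refine ⟨⟨N, hN.1, hN.2.2, ?_, rfl⟩, le_inf hX hN.2.1⟩
      rw [hfib N hNS]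
      exact hodd.add_one
  have hsum := Finset.card_eq_sum_card_image (M ⊓ ·) S
  have hodd : Odd S.card ↔ Odd {Y ∈ evenRestricted A M | X ≤ Y}.ncard := by
    rw [hrestr, Set.ncard_coe_finset, ← Finset.odd_sum_iff_odd_card_odd, ← hsum]
  rw [hcard]
  rcases Nat.even_or_odd S.card with h | h
  · have : Even {Y ∈ evenRestricted A M | X ≤ Y}.ncard := by
      rw [← Nat.not_odd_iff_even, ← hodd, Nat.not_odd_iff_even]; exact h
    grind
  · have := hodd.1 h
    grind

/-! ### Parity and dimension along an even restriction sequence -/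

section Sequence

variable {E : Finset V} {r : ℕ}

theorem seqSpace_zero (e : Fin r → E) : seqSpace e 0 = ⊤ := by
  simp [seqSpace]

theorem mem_seqSpace {e : Fin r → E} {i : ℕ} {x : V} :
    x ∈ seqSpace e i ↔ ∀ j : Fin r, (j : ℕ) < i → ⟪(e j : V), x⟫_ℝ = 0 := by
  simp [seqSpace, Submodule.mem_iInf, mem_hyp]

theorem seqSpace_succ (e : Fin r → E) (i : Fin r) :
    seqSpace e (i + 1) = seqSpace e i ⊓ hyp (e i : V) := by
  ext x
  simp only [Submodule.mem_inf, mem_seqSpace, mem_hyp]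
  constructor
  · exact fun h => ⟨fun j hj => h j (by omega), h i (by omega)⟩
  · rintro ⟨h1, h2⟩ j hj
    rcases Nat.lt_succ_iff_lt_or_eq.1 hj with h | h
    · exact h1 j h
    · rwa [Fin.ext h]

theorem seqSpace_antitone (e : Fin r → E) : Antitone (seqSpace e) := fun _ _ hij _ hx =>
  mem_seqSpace.2 fun k hk => mem_seqSpace.1 hx k (hk.trans_le hij)

theorem finite_seqArr (e : Fin r → E) (i : ℕ) : (seqArr e i).Finite := by
  induction i with
  | zero => exact finite_hyperplanes E
  | succ i ih => exact finite_evenRestricted ih _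

theorem IsEvenSeq.seqArr_covBy (hE : IsArrangement E) {e : Fin r → E} (he : IsEvenSeq e) {i : ℕ}
    (hi : i ≤ r) : ∀ K ∈ seqArr e i, K ⋖ seqSpace e i := by
  induction i with
  | zero =>
    rintro K ⟨x, hx, rfl⟩
    rw [seqSpace_zero]
    exact hyp_covBy_top (hE.ne_zero hx)
  | succ i ih => exact evenRestricted_covBy (ih (by omega)) (he ⟨i, hi⟩)

-- Each restriction flips the parity of the number of members through `X`, and the summand `i`
-- records the flips.
open Classical in
theorem IsEvenSeq.even_card_add_ncard_add (hE : IsArrangement E) {e : Fin r → E}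
    (he : IsEvenSeq e) {i : ℕ} (hi : i ≤ r) {X : Submodule ℝ V} (hX : X ≤ seqSpace e i) :
    Even ((E.filter fun x => X ≤ hyp x).card + {K ∈ seqArr e i | X ≤ K}.ncard + i) := by
  induction i with
  | zero =>
    have h : {K ∈ seqArr e 0 | X ≤ K} = hyp '' (E.filter fun x => X ≤ hyp x : Finset V) := by
      ext K
      simp only [seqArr, hyperplanes, Set.mem_ofPred_eq, Finset.coe_filter, Set.mem_image]
      constructor
      · rintro ⟨⟨x, hx, rfl⟩, h⟩
        exact ⟨x, ⟨hx, h⟩, rfl⟩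
      · rintro ⟨x, ⟨hx, h⟩, rfl⟩
        exact ⟨⟨x, hx, rfl⟩, h⟩
    rw [h, (hE.hyp_injOn.mono (Finset.coe_subset.2 (Finset.filter_subset _ _))).ncard_image,
      Set.ncard_coe_finset]
    simp
  | succ i ih =>
    have h1 := ih (by omega) (hX.trans (seqSpace_antitone e i.le_succ))
    have h2 := even_ncard_add_ncard_evenRestricted_add_one (finite_seqArr e i)
      (he.seqArr_covBy hE (by omega)) (he ⟨i, hi⟩) hX
    simp only [seqArr] at *
    grind

open Classical in
/-- The parity of the number of hyperplanes that contain a member of the flag of an even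
restriction sequence. -/
theorem IsEvenSeq.even_card_add (hE : IsArrangement E) {e : Fin r → E}
    (he : IsEvenSeq e) {i : ℕ} (hi : i ≤ r) :
    Even ((E.filter fun x => seqSpace e i ≤ hyp x).card + i) := by
  cases i with
  | zero =>
    have : (E.filter fun x => seqSpace e 0 ≤ hyp x) = ∅ := by
      refine Finset.filter_eq_empty_iff.2 fun x hx h => ?_
      rw [seqSpace_zero] at h
      exact (hyp_covBy_top (hE.ne_zero hx)).lt.not_ge h
    simp [this]
  | succ i =>
    have h1 := he.even_card_add_ncard_add hE (i := i) (by omega)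
      (seqSpace_antitone e i.le_succ)
    have hmem := he ⟨i, hi⟩
    have hcov := he.seqArr_covBy hE (i := i) (by omega)
    -- Take `X` to be the next member of the flag: as a hyperplane of the current space it lies in
    -- no member but itself.
    have h2 : {K ∈ seqArr e i | seqSpace e (i + 1) ≤ K} = {seqSpace e (i + 1)} := by
      ext K
      simp only [Set.mem_ofPred_eq, Set.mem_singleton_iff]
      constructor
      · rintro ⟨hK, hle⟩
        exact ((hcov _ hmem).eq_or_eq hle (hcov K hK).le).resolve_right (hcov K hK).ne
      · rintro rfl
        exact ⟨hmem, le_rfl⟩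
    rw [h2, Set.ncard_singleton] at h1
    simpa [add_assoc, add_comm] using h1

-- The numbers of hyperplanes through consecutive members of the flag have opposite parities. This
-- makes the sign of the chamber change when one normal is reversed.
open Classical in
theorem IsEvenSeq.odd_card (hE : IsArrangement E) {e : Fin r → E} (he : IsEvenSeq e)
    (i : Fin r) :
    Odd (E.filter fun x => seqSpace e (i + 1) ≤ hyp x ∧ ¬ seqSpace e i ≤ hyp x).card := by
  have h1 := he.even_card_add hE (i := i) (by omega)
  have h2 := he.even_card_add hE (i := i + 1) (by omega)
  have h3 := Finset.card_filter_add_card_filter_not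
    (s := E.filter fun x => seqSpace e (i + 1) ≤ hyp x) (p := fun x => seqSpace e i ≤ hyp x)
  rw [Finset.filter_filter, Finset.filter_filter] at h3
  have h4 : (E.filter fun x => seqSpace e (i + 1) ≤ hyp x ∧ seqSpace e i ≤ hyp x) =
      E.filter fun x => seqSpace e i ≤ hyp x :=
    Finset.filter_congr fun x _ =>
      ⟨fun h => h.2, fun h => ⟨(seqSpace_antitone e (Nat.le_succ i)).trans h, h⟩⟩
  rw [h4] at h3
  grind

theorem IsEvenSeq.succ_covBy (hE : IsArrangement E) {e : Fin r → E} (he : IsEvenSeq e)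
    (i : Fin r) : seqSpace e (i + 1) ⋖ seqSpace e i :=
  he.seqArr_covBy hE i.2.le _ (he i)

theorem IsEvenSeq.finrank_seqSpace_add_le [FiniteDimensional ℝ V] (hE : IsArrangement E)
    {e : Fin r → E} (he : IsEvenSeq e) {i : ℕ} (hi : i ≤ r) :
    Module.finrank ℝ (seqSpace e i) + i ≤ Module.finrank ℝ V := by
  induction i with
  | zero => simpa using Submodule.finrank_le _
  | succ i ih =>
    have h1 := ih (by omega)
    have h2 := Submodule.finrank_lt_finrank_of_lt (he.succ_covBy hE ⟨i, hi⟩).lt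
    simp only at h2
    omega

theorem IsEvenSeq.seqSpace_eq_bot [FiniteDimensional ℝ V] (hE : IsArrangement E)
    {e : Fin r → E} (he : IsEvenSeq e) (hr : r = Module.finrank ℝ V) : seqSpace e r = ⊥ := by
  have := he.finrank_seqSpace_add_le hE le_rfl
  exact Submodule.finrank_eq_zero.1 (by omega)

end Sequence

/-! ### Signs of chambers and orientation of normals -/

section Sign

/-- The factor contributed to the sign of a chamber by a hyperplane on whose side `s` it lies. -/
def sideSign (s : SignType) : ℝ := if s = -1 then -1 else 1

theorem sideSign_neg {s : SignType} (hs : s ≠ 0) : sideSign (-s) = -sideSign s := by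
  cases s <;> simp_all [sideSign]

theorem sideSign_mul_self (s : SignType) : sideSign s * sideSign s = 1 := by
  unfold sideSign
  split_ifs <;> norm_num

omit [NormedAddCommGroup V] [InnerProductSpace ℝ V] in
theorem chamberSign_eq_prod (E : Finset V) (X : V → SignType) :
    chamberSign E X = ∏ e ∈ E, sideSign (X e) := by
  classical
  unfold chamberSign sideSign
  rw [Finset.prod_ite, Finset.prod_const_one, mul_one, Finset.prod_const]

theorem chamberSign_compSign (E : Finset V) (X : V → SignType) (v : V) :
    chamberSign E (compSign X v) = chamberSign E X *
      ∏ e ∈ E with X e = 0, sideSign (SignType.sign ⟪e, v⟫_ℝ) := by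
  rw [chamberSign_eq_prod, chamberSign_eq_prod, Finset.prod_filter, ← Finset.prod_mul_distrib]
  refine Finset.prod_congr rfl fun e _ => ?_
  by_cases h : X e = 0 <;> simp [compSign, h, sideSign]

theorem flagSign_zero (v : Fin 0 → V) : flagSign v = fun _ => 0 := by
  simp [flagSign]

/-- The vector `v 0` is the weakest perturbation: it decides the side only where all later vectors
give zero. -/
theorem flagSign_succ {r : ℕ} (v : Fin (r + 1) → V) :
    flagSign v = compSign (flagSign fun i : Fin r => v i.succ) (v 0) := by
  simp [flagSign, List.ofFn_succ]

theorem flagSign_eq_zero_iff {r : ℕ} (v : Fin r → V) (x : V) :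
    flagSign v x = 0 ↔ ∀ i, ⟪x, v i⟫_ℝ = 0 := by
  induction r with
  | zero => simp [flagSign_zero]
  | succ r ih =>
    rw [flagSign_succ, Fin.forall_fin_succ, ← ih (fun i => v i.succ)]
    unfold compSign
    split_ifs with h <;> simp [h]

theorem flagSign_neg {r : ℕ} (v : Fin r → V) (x : V) : flagSign v (-x) = -flagSign v x := by
  induction r with
  | zero => simp [flagSign_zero]
  | succ r ih =>
    simp only [flagSign_succ, compSign, ih, inner_neg_left, Left.sign_neg]
    by_cases h : flagSign (fun i : Fin r => v i.succ) x = 0 <;> simp [h]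

theorem flagSign_map {r : ℕ} (w : V ≃ₗᵢ[ℝ] V) (v : Fin r → V) (x : V) :
    flagSign (fun i => w (v i)) (w x) = flagSign v x := by
  induction r with
  | zero => simp [flagSign_zero]
  | succ r ih => simp only [flagSign_succ, compSign, ih, LinearIsometryEquiv.inner_map_map]

theorem flagSign_ne_neg_one {r : ℕ} {v : Fin r → V} {x : V} (h : ∀ i, 0 ≤ ⟪x, v i⟫_ℝ) :
    flagSign v x ≠ -1 := by
  induction r with
  | zero => simp [flagSign_zero]
  | succ r ih =>
    rw [flagSign_succ, compSign]
    split_ifs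
    · intro h1
      exact (sign_eq_neg_one_iff.1 h1).not_ge (h 0)
    · exact ih fun i => h i.succ

/-- Changing the orientation of vectors of a flag changes the sign of the chamber accordingly, if
for each vector the number of hyperplanes that contain all later vectors but not this one is
odd. -/
theorem chamberSign_flagSign_smul {E : Finset V} {r : ℕ} (v : Fin r → V) (c : Fin r → ℝ)
    (hc : ∀ i, c i = 1 ∨ c i = -1)
    (hodd : ∀ i, Odd {x : V | x ∈ E ∧ (∀ j, i < j → ⟪x, v j⟫_ℝ = 0) ∧ ⟪x, v i⟫_ℝ ≠ 0}.ncard) :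
    chamberSign E (flagSign fun i => c i • v i) =
      (∏ i, c i) * chamberSign E (flagSign v) := by
  classical
  induction r with
  | zero => simp [flagSign_zero]
  | succ r ih =>
    have ht := ih (fun i => v i.succ) (fun i => c i.succ) (fun i => hc i.succ) (fun i => by
      simpa [Fin.forall_fin_succ] using hodd i.succ)
    rw [flagSign_succ, flagSign_succ v, chamberSign_compSign, chamberSign_compSign, ht,
      Fin.prod_univ_succ]
    have hz : ∀ x, flagSign (fun i : Fin r => c i.succ • v i.succ) x = 0 ↔
        flagSign (fun i : Fin r => v i.succ) x = 0 := by
      intro x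
      simp only [flagSign_eq_zero_iff, real_inner_smul_right, mul_eq_zero]
      refine forall_congr' fun i => or_iff_right ?_
      rcases hc i.succ with h | h <;> norm_num [h]
    simp only [hz]
    -- Only hyperplanes containing all later vectors see `v 0`. Reversing it flips the factors of
    -- those that do not contain it, and their number is odd.
    have key : ∏ x ∈ E with flagSign (fun i : Fin r => v i.succ) x = 0,
          sideSign (SignType.sign ⟪x, c 0 • v 0⟫_ℝ) =
        c 0 * ∏ x ∈ E with flagSign (fun i : Fin r => v i.succ) x = 0,
          sideSign (SignType.sign ⟪x, v 0⟫_ℝ) := by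
      rcases hc 0 with h | h
      · simp [h]
      · have h0 := hodd 0
        have hset : {x : V | x ∈ E ∧ (∀ j, 0 < j → ⟪x, v j⟫_ℝ = 0) ∧ ⟪x, v 0⟫_ℝ ≠ 0} =
            (({x ∈ {x ∈ E | flagSign (fun i : Fin r => v i.succ) x = 0} | ⟪x, v 0⟫_ℝ ≠ 0} :
              Finset V) : Set V) := by
          ext x
          simp [Fin.forall_fin_succ, flagSign_eq_zero_iff, and_assoc]
        rw [hset, Set.ncard_coe_finset] at h0
        have hpow := h0.neg_one_pow (α := ℝ)
        rw [← Finset.prod_const, Finset.prod_filter] at hpow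
        simp only [h, neg_smul, one_smul, inner_neg_right, Left.sign_neg]
        conv_rhs => rw [← hpow, ← Finset.prod_mul_distrib]
        refine Finset.prod_congr rfl fun x _ => ?_
        by_cases hx : ⟪x, v 0⟫_ℝ = 0
        · simp [hx]
        · rw [if_pos hx, sideSign_neg (sign_ne_zero.2 hx), neg_one_mul]
    rw [key]
    ring

end Sign

/-! ### Unit normals of complete flags -/

section Frame

variable {r : ℕ} {M : ℕ → Submodule ℝ V} {v v' : Fin r → V} {E : Finset V}

/-- `v` consists of unit normal vectors of the members of the complete flag `M`, each inside the
preceding member. -/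
structure IsFrame (M : ℕ → Submodule ℝ V) (v : Fin r → V) : Prop where
  norm_eq_one : ∀ i, ‖v i‖ = 1
  mem : ∀ i : Fin r, v i ∈ M i
  succ : ∀ i : Fin r, M (i + 1) = M i ⊓ hyp (v i)
  zero : M 0 = ⊤
  last : M r = ⊥

/-- The vectors from index `k` on span `M k`; the descending induction adds one normal at a time. -/
theorem IsFrame.forall_inner_eq_zero_iff (hv : IsFrame M v) {k : ℕ} (hk : k ≤ r) (x : V) :
    (∀ j : Fin r, k ≤ j → ⟪x, v j⟫_ℝ = 0) ↔ M k ≤ hyp x := by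
  induction hk using Nat.decreasingInduction with
  | self =>
    rw [hv.last]
    simp only [bot_le, iff_true]
    exact fun j hj => absurd j.2 (by omega)
  | of_succ k hk ih =>
    have hs := hv.succ ⟨k, hk⟩
    simp only at hs
    constructor
    · intro h y hy
      have h1 := ih.1 fun j hj => h j (by omega)
      have hn := real_inner_self_eq_norm_sq (v ⟨k, hk⟩)
      rw [hv.norm_eq_one] at hn
      -- Removing the component along the normal moves `y` into the next member of the flag.
      have h2 : y - ⟪v ⟨k, hk⟩, y⟫_ℝ • v ⟨k, hk⟩ ∈ M (k + 1) := by
        rw [hs]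
        refine ⟨sub_mem hy (Submodule.smul_mem _ _ (hv.mem ⟨k, hk⟩)), mem_hyp.2 ?_⟩
        rw [inner_sub_right, real_inner_smul_right, hn]
        ring
      have h3 := mem_hyp.1 (h1 h2)
      rw [inner_sub_right, real_inner_smul_right, h ⟨k, hk⟩ le_rfl] at h3
      exact mem_hyp.2 (by linarith)
    · intro h j hj
      rcases hj.eq_or_lt with h1 | h1
      · have := hv.mem j
        rw [← h1] at this
        exact mem_hyp.1 (h this)
      · exact ih.2 ((hs ▸ inf_le_left).trans h) j h1

/-- With `c = (v i, v' i)`, the difference `v' i - c • v i` lies in `M (i + 1)`. Hence it is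
orthogonal to both normals, and so to itself. -/
theorem IsFrame.eq_smul (hv : IsFrame M v) (hv' : IsFrame M v') (i : Fin r) :
    ∃ c : ℝ, (c = 1 ∨ c = -1) ∧ v' i = c • v i := by
  have hn := real_inner_self_eq_norm_sq (v i)
  have hn' := real_inner_self_eq_norm_sq (v' i)
  rw [hv.norm_eq_one] at hn
  rw [hv'.norm_eq_one] at hn'
  set c := ⟪v i, v' i⟫_ℝ with hc
  have h1 : v' i - c • v i ∈ M i ⊓ hyp (v i) := by
    refine ⟨sub_mem (hv'.mem i) (Submodule.smul_mem _ _ (hv.mem i)), mem_hyp.2 ?_⟩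
    rw [inner_sub_right, real_inner_smul_right, hn]
    ring
  have h2 := h1
  rw [← hv.succ, hv'.succ] at h2
  have h3 := mem_hyp.1 h2.2
  rw [inner_sub_right, real_inner_smul_right, hn', real_inner_comm, ← hc] at h3
  have h4 : v' i - c • v i = 0 := by
    rw [← inner_self_eq_zero (𝕜 := ℝ), inner_sub_left, real_inner_smul_left,
      mem_hyp.1 h1.2, mem_hyp.1 h2.2]
    ring
  refine ⟨c, ?_, sub_eq_zero.1 h4⟩
  exact mul_self_eq_one_iff.1 (by linarith)

/-- The contribution of a flag with unit normal vectors `v`. -/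
def flagTerm (E : Finset V) (v : Fin r → V) (a : V) : ℝ :=
  chamberSign E (flagSign v) * ∏ i, ⟪a, v i⟫_ℝ

/-- Passing to other normals multiplies both the sign of the chamber and the product of linear forms
by the same product of signs `c i`, whose square is one. -/
theorem IsFrame.flagTerm_eq (hv : IsFrame M v) (hv' : IsFrame M v')
    (hodd : ∀ i : Fin r, Odd {x : V | x ∈ E ∧ M (i + 1) ≤ hyp x ∧ ¬ M i ≤ hyp x}.ncard) (a : V) :
    flagTerm E v' a = flagTerm E v a := by
  choose c hc hcv using hv.eq_smul hv'
  have h := chamberSign_flagSign_smul (E := E) v c hc fun i => by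
    convert hodd i using 3
    ext x
    refine and_congr_right fun _ => ?_
    rw [← hv.forall_inner_eq_zero_iff (by omega), ← hv.forall_inner_eq_zero_iff (by omega)]
    simp only [Nat.succ_le_iff, Fin.val_fin_lt]
    refine and_congr_right fun h => not_congr ⟨fun h1 j hj => ?_, fun h1 => h1 i le_rfl⟩
    rcases hj.eq_or_lt with h2 | h2
    · rwa [← Fin.ext h2]
    · exact h j h2
  have hv'' : v' = fun i => c i • v i := funext hcv
  rw [flagTerm, flagTerm, hv'', h]
  simp only [real_inner_smul_right, Finset.prod_mul_distrib]
  have : (∏ i, c i) * ∏ i, c i = 1 := by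
    rw [← Finset.prod_mul_distrib]
    refine Finset.prod_eq_one fun i _ => ?_
    rcases hc i with h | h <;> norm_num [h]
  linear_combination chamberSign E (flagSign v) * (∏ i, ⟪a, v i⟫_ℝ) * this

theorem IsFrame.map (hv : IsFrame M v) (w : V ≃ₗᵢ[ℝ] V) :
    IsFrame (fun i => (M i).map (w.toLinearEquiv : V →ₗ[ℝ] V)) (fun i => w (v i)) where
  norm_eq_one i := by simpa using hv.norm_eq_one i
  mem i := ⟨v i, hv.mem i, rfl⟩
  succ i := by
    rw [hv.succ]
    ext x
    obtain ⟨y, rfl⟩ := w.surjective x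
    simp [mem_hyp]
  zero := by
    simp only [hv.zero, Submodule.map_top]
    exact LinearEquiv.range _
  last := by simp [hv.last]

variable [FiniteDimensional ℝ V]

theorem IsEvenSeq.isFrame (hE : IsArrangement E) {e : Fin r → E} (he : IsEvenSeq e)
    (hr : r = Module.finrank ℝ V) : IsFrame (seqSpace e) (unitNormal e) := by
  have hin : ∀ (i : Fin r), ∀ x ∈ seqSpace e i,
      ⟪(seqSpace e i).starProjection (e i : V), x⟫_ℝ = ⟪(e i : V), x⟫_ℝ := by
    intro i x hx
    rw [Submodule.inner_starProjection_left_eq_right, Submodule.starProjection_eq_self_iff.2 hx]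
  have hne : ∀ i : Fin r, (seqSpace e i).starProjection (e i : V) ≠ 0 := by
    intro i h0
    refine (he.succ_covBy hE i).ne ?_
    rw [seqSpace_succ, inf_eq_left]
    intro x hx
    rw [mem_hyp, ← hin i x hx, h0, inner_zero_left]
  refine ⟨fun i => ?_, fun i => ?_, fun i => ?_, seqSpace_zero e, he.seqSpace_eq_bot hE hr⟩
  · rw [unitNormal, norm_smul, norm_inv, norm_norm, inv_mul_cancel₀ (norm_ne_zero_iff.2 (hne i))]
  · exact Submodule.smul_mem _ _ (Submodule.starProjection_apply_mem _ _)
  · rw [seqSpace_succ]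
    ext x
    simp only [Submodule.mem_inf, mem_hyp]
    refine and_congr_right fun hx => ?_
    rw [unitNormal, real_inner_smul_left, hin i x hx, mul_eq_zero,
      or_iff_right (inv_ne_zero (norm_ne_zero_iff.2 (hne i)))]

theorem seqTerm_eq_flagTerm (e : Fin r → E) (a : V) :
    seqTerm e a = flagTerm E (unitNormal e) a := by
  unfold seqTerm flagTerm
  congr 1
  refine Finset.prod_congr rfl fun i _ => ?_
  rw [Submodule.inner_starProjection_left_eq_right, Submodule.starProjection_eq_self_iff.2]
  exact Submodule.smul_mem _ _ (Submodule.starProjection_apply_mem _ _)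

omit [FiniteDimensional ℝ V] in
theorem IsEvenSeq.odd_ncard (hE : IsArrangement E) {e : Fin r → E} (he : IsEvenSeq e)
    (i : Fin r) :
    Odd {x : V | x ∈ E ∧ seqSpace e (i + 1) ≤ hyp x ∧ ¬ seqSpace e i ≤ hyp x}.ncard := by
  classical
  have := he.odd_card hE i
  rw [← Set.ncard_coe_finset] at this
  simpa using this

end Frame

/-! ### Reflections acting on flags, and vanishing on mirrors -/

section Symmetry

variable {r : ℕ} {E : Finset V}

theorem evenRestricted_image (φ : Submodule ℝ V ≃o Submodule ℝ V) (A : Set (Submodule ℝ V))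
    (M : Submodule ℝ V) : evenRestricted (φ '' A) (φ M) = φ '' evenRestricted A M := by
  have hcount : ∀ N, {K ∈ φ '' A | φ M ⊓ φ N ≤ K}.ncard = {K ∈ A | M ⊓ N ≤ K}.ncard := by
    intro N
    refine (congrArg Set.ncard ?_).trans (Set.ncard_image_of_injective _ φ.injective)
    ext K
    constructor
    · rintro ⟨⟨K, hK, rfl⟩, hle⟩
      exact ⟨K, ⟨hK, by rwa [← φ.map_inf, φ.le_iff_le] at hle⟩, rfl⟩
    · rintro ⟨K, ⟨hK, hle⟩, rfl⟩
      exact ⟨⟨K, hK, rfl⟩, by rwa [← φ.map_inf, φ.le_iff_le]⟩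
  ext X
  constructor
  · rintro ⟨_, ⟨N, hN, rfl⟩, hne, hev, rfl⟩
    exact ⟨M ⊓ N, ⟨N, hN, fun h => hne (h ▸ rfl), hcount N ▸ hev, rfl⟩, φ.map_inf _ _⟩
  · rintro ⟨_, ⟨N, hN, hne, hev, rfl⟩, rfl⟩
    exact ⟨φ N, ⟨N, hN, rfl⟩, φ.injective.ne hne, (hcount N).symm ▸ hev, φ.map_inf _ _⟩

/-- The action of a linear isometry on subspaces. -/
def mapIso (w : V ≃ₗᵢ[ℝ] V) : Submodule ℝ V ≃o Submodule ℝ V :=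
  Submodule.orderIsoMapComap w.toLinearEquiv

theorem mapIso_hyp (w : V ≃ₗᵢ[ℝ] V) (x : V) : mapIso w (hyp x) = hyp (w x) := by
  ext y
  obtain ⟨y, rfl⟩ := w.surjective y
  simp [mapIso, Submodule.orderIsoMapComap_apply, mem_hyp]

theorem Preserves.image_hyperplanes {w : V ≃ₗᵢ[ℝ] V} (hw : Preserves w E) :
    mapIso w '' hyperplanes E = hyperplanes E := by
  refine Set.eq_of_subset_of_ncard_le ?_ ?_ (finite_hyperplanes E)
  · rintro _ ⟨H, hH, rfl⟩
    exact hw H hH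
  · rw [Set.ncard_image_of_injective _ (mapIso w).injective]

theorem Preserves.exists_hyp_eq {w : V ≃ₗᵢ[ℝ] V} (hw : Preserves w E) (x : E) :
    ∃ y : E, hyp (y : V) = mapIso w (hyp (x : V)) := by
  obtain ⟨y, hy, h⟩ := hw _ ⟨x, x.2, rfl⟩
  exact ⟨⟨y, hy⟩, h.symm⟩

theorem seqSpace_eq_mapIso {w : V ≃ₗᵢ[ℝ] V} {e f : Fin r → E}
    (h : ∀ i, hyp (f i : V) = mapIso w (hyp (e i : V))) (i : ℕ) :
    seqSpace f i = mapIso w (seqSpace e i) := by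
  simp only [seqSpace, h, OrderIso.map_iInf]

theorem seqArr_eq_image {w : V ≃ₗᵢ[ℝ] V} (hw : Preserves w E) {e f : Fin r → E}
    (h : ∀ i, hyp (f i : V) = mapIso w (hyp (e i : V))) (i : ℕ) :
    seqArr f i = mapIso w '' seqArr e i := by
  induction i with
  | zero => exact hw.image_hyperplanes.symm
  | succ i ih =>
    simp only [seqArr]
    rw [ih, seqSpace_eq_mapIso h, evenRestricted_image]

theorem IsEvenSeq.of_hyp_eq {w : V ≃ₗᵢ[ℝ] V} (hw : Preserves w E) {e f : Fin r → E}
    (h : ∀ i, hyp (f i : V) = mapIso w (hyp (e i : V))) (he : IsEvenSeq e) : IsEvenSeq f := by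
  intro i
  rw [seqArr_eq_image hw h, seqSpace_eq_mapIso h]
  exact ⟨_, he i, rfl⟩

variable [FiniteDimensional ℝ V]

omit [FiniteDimensional ℝ V] in
theorem IsFrame.congr {M N : ℕ → Submodule ℝ V} {v : Fin r → V} (hv : IsFrame M v)
    (h : ∀ i ≤ r, M i = N i) : IsFrame N v where
  norm_eq_one := hv.norm_eq_one
  mem i := h i i.2.le ▸ hv.mem i
  succ i := by rw [← h _ i.2.le, ← h _ i.2, hv.succ]
  zero := h 0 (Nat.zero_le _) ▸ hv.zero
  last := h r le_rfl ▸ hv.last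

theorem IsEvenSeq.seqTerm_eq (hE : IsArrangement E) {e : Fin r → E} (he : IsEvenSeq e)
    (hr : r = Module.finrank ℝ V) {v : Fin r → V} (hv : IsFrame (seqSpace e) v) (a : V) :
    seqTerm e a = flagTerm E v a := by
  rw [seqTerm_eq_flagTerm]
  exact hv.flagTerm_eq (he.isFrame hE hr) (fun i => he.odd_ncard hE i) a

omit [FiniteDimensional ℝ V] in
theorem IsFrame.flagSign_ne_zero {M : ℕ → Submodule ℝ V} {v : Fin r → V} (hv : IsFrame M v)
    {x : V} (hx : x ≠ 0) : flagSign v x ≠ 0 := by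
  intro h
  rw [flagSign_eq_zero_iff] at h
  have h1 := (hv.forall_inner_eq_zero_iff (Nat.zero_le _) x).1 fun j _ => h j
  rw [hv.zero] at h1
  exact (hyp_covBy_top hx).lt.not_ge h1

theorem hyp_reflection_self (h : V) : (hyp h).reflection h = -h :=
  Submodule.reflection_orthogonalComplement_singleton_eq_neg h

/-- A reflection in a hyperplane of the arrangement changes the sign of each chamber. -/
theorem IsFrame.chamberSign_reflection (hE : IsArrangement E) {M : ℕ → Submodule ℝ V}
    {v : Fin r → V} (hv : IsFrame M v) {h : V} (hh : h ∈ E)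
    (hw : Preserves (hyp h).reflection E) :
    chamberSign E (flagSign fun i => (hyp h).reflection (v i)) =
      -chamberSign E (flagSign v) := by
  classical
  set s := (hyp h).reflection with hs
  have hss : ∀ x, s (s x) = x := (hyp h).reflection_reflection
  have hmem : ∀ x ∈ E, s x ∈ E ∨ -s x ∈ E := by
    intro x hx
    obtain ⟨y, hy⟩ := hw.exists_hyp_eq ⟨x, hx⟩
    rw [mapIso_hyp] at hy
    rcases eq_or_eq_neg_of_hyp_eq (hE.norm_eq_one _ y.2)
      ((s.norm_map x).trans (hE.norm_eq_one x hx)) hy with h1 | h1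
    · left
      have := y.2
      rwa [h1] at this
    · right
      have := y.2
      rwa [h1] at this
  set X := flagSign v with hX
  have hX0 : ∀ {x}, x ∈ E → X x ≠ 0 := fun hx => hv.flagSign_ne_zero (hE.ne_zero hx)
  have hXs : ∀ {x}, x ∈ E → X (s x) ≠ 0 := fun hx =>
    hv.flagSign_ne_zero (s.map_ne_zero_iff.2 (hE.ne_zero hx))
  have hXneg : ∀ x, X (-x) = -X x := flagSign_neg v
  have hflag : ∀ x, flagSign (fun i => s (v i)) x = X (s x) := by
    intro x
    conv_lhs => rw [← hss x, flagSign_map]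
  -- The vector `h` goes to `-h` and contributes `-1`. The other members of `E` are permuted by the
  -- involution sending `x` to whichever of `s x` and `-s x` lies in `E`, and the factors at paired
  -- vectors cancel.
  have hprod : ∏ x ∈ E, sideSign (X (s x)) * sideSign (X x) = -1 := by
    rw [← Finset.mul_prod_erase E _ hh, hs, hyp_reflection_self, hXneg, sideSign_neg (hX0 hh),
      neg_mul, sideSign_mul_self, neg_one_mul, neg_inj, ← hs]
    have hσ : ∀ x ∈ E.erase h, (if s x ∈ E then s x else -s x) ∈ E.erase h := by
      intro x hx
      rw [Finset.mem_erase] at hx ⊢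
      have hsh : s h = -h := hyp_reflection_self h
      split_ifs with h1
      · refine ⟨fun h2 => hE.neg_notMem x hx.2 ?_, h1⟩
        have h3 := congrArg s h2
        rw [hss, hsh] at h3
        simpa [h3] using hh
      · refine ⟨fun h2 => hx.1 ?_, (hmem x hx.2).resolve_left h1⟩
        have h3 := congrArg s h2
        rw [map_neg, hss, hsh] at h3
        exact neg_injective h3
    refine Finset.prod_involution (fun x _ => if s x ∈ E then s x else -s x) ?_ ?_ hσ ?_
    · intro x hx
      have hxE := Finset.mem_of_mem_erase hx
      split_ifs with h1
      · rw [hss]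
        linear_combination sideSign_mul_self (X (s x)) * sideSign (X x) * sideSign (X x) +
          sideSign_mul_self (X x)
      · rw [map_neg, hss, hXneg, hXneg, sideSign_neg (hX0 hxE), sideSign_neg (hXs hxE)]
        linear_combination sideSign_mul_self (X (s x)) * sideSign (X x) * sideSign (X x) +
          sideSign_mul_self (X x)
    -- At a fixed point, either `s x = x` and the factor is a square, or `s x = -x`. The latter puts
    -- `x` on the line of `h`, so `x` is `h` or `-h`, and both are excluded.
    · intro x hx hne heq
      rw [Finset.mem_erase] at hx
      split_ifs at heq with h1
      · exact hne (by rw [heq, sideSign_mul_self])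
      · have h2 : s x = -x := by rw [← heq, neg_neg, heq]
        have h3 : x ∈ (hyp h)ᗮ := by
          rw [← Submodule.reflection_eq_self_iff, Submodule.reflection_orthogonal_apply, ← hs, h2,
            neg_neg]
        rw [hyp, Submodule.orthogonal_orthogonal] at h3
        obtain ⟨c, rfl⟩ := Submodule.mem_span_singleton.1 h3
        have h4 := hE.norm_eq_one _ hx.2
        rw [norm_smul, hE.norm_eq_one h hh, mul_one, Real.norm_eq_abs] at h4
        rcases eq_or_eq_neg_of_abs_eq h4 with rfl | rfl
        · simp at hx
        · exact hE.neg_notMem h hh (by simpa using hx.2)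
    · intro x hx
      have hxE := Finset.mem_of_mem_erase hx
      by_cases h1 : s x ∈ E
      · simp [h1, hss, hxE]
      · simp [h1, hss, hE.neg_notMem x hxE]
  rw [chamberSign_eq_prod, chamberSign_eq_prod]
  simp only [hflag]
  rw [Finset.prod_mul_distrib] at hprod
  have hsq : (∏ x ∈ E, sideSign (X x)) * ∏ x ∈ E, sideSign (X x) = 1 := by
    rw [← Finset.prod_mul_distrib]
    exact Finset.prod_eq_one fun x _ => sideSign_mul_self _
  linear_combination (∏ x ∈ E, sideSign (X x)) * hprod -
    (∏ x ∈ E, sideSign (X (s x))) * hsq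

/-- The polynomial of the arrangement vanishes on the hyperplanes of the arrangement whose
reflections preserve the arrangement. -/
theorem pizzaPoly_eq_zero_of_mem_hyp (hE : IsArrangement E) {h : V} (hh : h ∈ E)
    (hw : Preserves (hyp h).reflection E) {a : V} (ha : a ∈ hyp h) : pizzaPoly E a = 0 := by
  classical
  set s := (hyp h).reflection with hs
  choose σ hσ using hw.exists_hyp_eq
  set n := Module.finrank ℝ V with hn
  let g : Quotient (evenSeqSetoid E n) → Quotient (evenSeqSetoid E n) := fun c =>
    ⟦⟨fun i => σ ((Quotient.out c).1 i), (Quotient.out c).2.of_hyp_eq hw fun i => hσ _⟩⟧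
  -- The representative of the image class need not be the image of the representative, but its flag
  -- is the image flag, which is all that the term depends on.
  have hg : ∀ c, ∀ i ≤ n,
      seqSpace (Quotient.out (g c)).1 i = mapIso s (seqSpace (Quotient.out c).1 i) := by
    intro c i hi
    rw [← seqSpace_eq_mapIso (w := s) (f := fun i => σ ((Quotient.out c).1 i)) (fun i => hσ _)]
    exact Quotient.mk_out (s := evenSeqSetoid E n) _ i hi
  have hinj : Function.Injective g := by
    intro c d hcd
    refine Quotient.out_equiv_out.1 fun i hi => (mapIso s).injective ?_
    rw [← hg c i hi, ← hg d i hi, hcd]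
  have hterm : ∀ c, seqTerm (Quotient.out (g c)).1 a = -seqTerm (Quotient.out c).1 a := by
    intro c
    have hv := (Quotient.out c).2.isFrame hE rfl
    rw [(Quotient.out (g c)).2.seqTerm_eq hE rfl
      ((hv.map s).congr fun i hi => (hg c i hi).symm), seqTerm_eq_flagTerm, flagTerm, flagTerm,
      hv.chamberSign_reflection hE hh hw, neg_mul]
    congr 2
    refine Finset.prod_congr rfl fun i _ => ?_
    have has : s a = a := Submodule.reflection_mem_subspace_eq_self ha
    conv_lhs => rw [← has, LinearIsometryEquiv.inner_map_map]
  have hsum := Equiv.sum_comp (Equiv.ofBijective g (Finite.injective_iff_bijective.1 hinj))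
    fun c => seqTerm (Quotient.out c).1 a
  simp only [Equiv.ofBijective_apply, hterm, Finset.sum_neg_distrib] at hsum
  unfold pizzaPoly
  rw [mul_eq_zero]
  right
  linarith

end Symmetry

/-! ### Sums of products of linear forms vanishing on hyperplanes -/

section Polynomial

open Polynomial

/-- A proper subspace has empty interior, so this is a finite intersection of dense open sets. -/
theorem dense_setOf_forall_inner_ne_zero [CompleteSpace V] {D : Finset V} (hD : ∀ u ∈ D, u ≠ 0) :
    Dense {a : V | ∀ u ∈ D, ⟪a, u⟫_ℝ ≠ 0} := by
  have h := dense_biInter_of_isOpen (S := (D : Set V)) (f := fun u => {a : V | ⟪a, u⟫_ℝ ≠ 0})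
    (fun u _ => isOpen_ne_fun (by fun_prop) continuous_const) D.countable_toSet fun u hu => by
      have h1 : {a : V | ⟪a, u⟫_ℝ ≠ 0} = (hyp u : Set V)ᶜ := by
        ext a
        simp [mem_hyp, real_inner_comm]
      rw [h1, ← interior_eq_empty_iff_dense_compl]
      by_contra hne
      exact (hyp_covBy_top (hD u hu)).ne
        (Submodule.eq_top_of_nonempty_interior' _ (Set.nonempty_iff_ne_empty.2 hne))
  convert h using 1
  ext a
  simp

variable {ι : Type*} [Fintype ι] {n : ℕ} (k : ι → ℝ) (v : ι → Fin n → V)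

/-- A sum of products of `n` linear forms, restricted to the line through `a` in direction `b`. -/
def linePoly (a b : V) : ℝ[X] :=
  ∑ c, C (k c) * ∏ i, (C ⟪b, v c i⟫_ℝ * X + C ⟪a, v c i⟫_ℝ)

theorem eval_linePoly (a b : V) (t : ℝ) :
    (linePoly k v a b).eval t = ∑ c, k c * ∏ i, ⟪a + t • b, v c i⟫_ℝ := by
  simp only [linePoly, eval_finsetSum, eval_mul, eval_C, eval_prod, eval_add, eval_X,
    inner_add_left, real_inner_smul_left]
  simp only [mul_comm t, add_comm]

theorem natDegree_linePoly_le (a b : V) : (linePoly k v a b).natDegree ≤ n := by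
  refine natDegree_sum_le_of_forall_le _ _ fun c _ => (natDegree_C_mul_le _ _).trans ?_
  refine (natDegree_prod_le _ _).trans ((Finset.sum_le_card_nsmul _ _ 1 fun i _ => ?_).trans ?_)
  · exact natDegree_linear_le
  · simp

/-- The coefficient of degree `n` is independent of `a`: it is the value of the form at `b`. -/
theorem coeff_linePoly (a b : V) :
    (linePoly k v a b).coeff n = ∑ c, k c * ∏ i, ⟪b, v c i⟫_ℝ := by
  simp only [linePoly, finsetSum_coeff, coeff_C_mul]
  refine Finset.sum_congr rfl fun c _ => ?_
  have h := coeff_prod_of_natDegree_le (Finset.univ : Finset (Fin n))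
    (fun i => C ⟪b, v c i⟫_ℝ * X + C ⟪a, v c i⟫_ℝ) 1 fun i _ => natDegree_linear_le
  rw [Finset.card_univ, Fintype.card_fin, mul_one] at h
  rw [h]
  simp

variable {k v} {S : Finset V} {b : V}

/-- If a sum of products of `n` linear forms vanishes on distinct hyperplanes, then it vanishes if
there are more than `n` of them, and it is a multiple of the product of the linear forms of the
hyperplanes if there are `n` of them. -/
theorem sum_prod_inner_eq_of_vanishing [CompleteSpace V] (hb : ∀ e ∈ S, 0 < ⟪e, b⟫_ℝ)
    (hS : ∀ e ∈ S, ‖e‖ = 1)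
    (hF : ∀ e ∈ S, ∀ a ∈ hyp e, ∑ c, k c * ∏ i, ⟪a, v c i⟫_ℝ = 0) :
    (n + 1 ≤ S.card → ∀ a, ∑ c, k c * ∏ i, ⟪a, v c i⟫_ℝ = 0) ∧
    (S.card = n → ∀ a, ∑ c, k c * ∏ i, ⟪a, v c i⟫_ℝ =
      (∑ c, k c * ∏ i, ⟪b, v c i⟫_ℝ) * ∏ e ∈ S, (⟪a, e⟫_ℝ / ⟪e, b⟫_ℝ)) := by
  classical
  -- The line through `a` in direction `b` meets `H_e` at parameter `-(a, e) / (e, b)`. These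
  -- parameters are distinct when `a` is orthogonal to no member of `D`. Members of `D` are nonzero
  -- because proportional unit vectors that are both positive on `b` coincide.
  set D : Finset V := ((S ×ˢ S).filter fun p => p.1 ≠ p.2).image
    fun p => (⟪p.1, b⟫_ℝ)⁻¹ • p.1 - (⟪p.2, b⟫_ℝ)⁻¹ • p.2 with hD
  have hD0 : ∀ u ∈ D, u ≠ 0 := by
    intro u hu h0
    simp only [hD, Finset.mem_image, Finset.mem_filter, Finset.mem_product, Prod.exists] at hu
    obtain ⟨e, f, ⟨⟨he, hf⟩, hne⟩, rfl⟩ := hu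
    have h1 := sub_eq_zero.1 h0
    have h2 := congrArg norm h1
    rw [norm_smul, norm_smul, hS e he, hS f hf, mul_one, mul_one, Real.norm_of_nonneg
      (inv_nonneg.2 (hb e he).le), Real.norm_of_nonneg (inv_nonneg.2 (hb f hf).le)] at h2
    rw [h2] at h1
    exact hne (smul_right_injective V (inv_ne_zero (hb f hf).ne') h1)
  have hdense := dense_setOf_forall_inner_ne_zero hD0
  set root : V → V → ℝ := fun a e => -(⟪a, e⟫_ℝ / ⟪e, b⟫_ℝ) with hroot
  have hinj : ∀ a ∈ {a : V | ∀ u ∈ D, ⟪a, u⟫_ℝ ≠ 0}, Set.InjOn (root a) S := by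
    intro a ha e he f hf hef
    by_contra hne
    refine ha ((⟪e, b⟫_ℝ)⁻¹ • e - (⟪f, b⟫_ℝ)⁻¹ • f)
      (Finset.mem_image.2 ⟨(e, f), Finset.mem_filter.2 ⟨Finset.mk_mem_product he hf, hne⟩, rfl⟩) ?_
    simp only [hroot, neg_inj, div_eq_inv_mul] at hef
    rw [inner_sub_right, real_inner_smul_right, real_inner_smul_right, hef, sub_self]
  have hzero : ∀ a, ∀ e ∈ S, (linePoly k v a b).eval (root a e) = 0 := by
    intro a e he
    rw [eval_linePoly]
    refine hF e he _ (mem_hyp.2 ?_)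
    rw [inner_add_right, real_inner_smul_right, real_inner_comm a e]
    simp only [hroot]
    rw [neg_mul, div_mul_cancel₀ _ (hb e he).ne', add_neg_cancel]
  have heval0 : ∀ a, (linePoly k v a b).eval 0 = ∑ c, k c * ∏ i, ⟪a, v c i⟫_ℝ := by
    intro a
    simp [eval_linePoly]
  constructor
  · intro hcard
    refine congrFun (Continuous.ext_on hdense (by fun_prop) continuous_const fun a ha => ?_)
    have h0 : linePoly k v a b = 0 := by
      refine eq_zero_of_natDegree_lt_card_of_eval_eq_zero' _ (S.image (root a)) ?_ ?_
      · simpa using hzero a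
      · rw [Finset.card_image_of_injOn (hinj a ha)]
        exact (natDegree_linePoly_le k v a b).trans_lt hcard
    rw [← heval0, h0, eval_zero]
  · intro hcard
    refine congrFun (Continuous.ext_on hdense (by fun_prop) (by fun_prop) fun a ha => ?_)
    -- The polynomial with the same top coefficient and the same `n` roots. The difference has
    -- degree below `n`, so it is zero.
    set Q : ℝ[X] := C (∑ c, k c * ∏ i, ⟪b, v c i⟫_ℝ) * ∏ e ∈ S, (C 1 * X + C (-root a e)) with hQ
    have hQdeg : Q.natDegree ≤ n := by
      refine (natDegree_C_mul_le _ _).trans ((natDegree_prod_le _ _).trans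
        ((Finset.sum_le_card_nsmul _ _ 1 fun i _ => natDegree_linear_le).trans ?_))
      simp [hcard]
    have hQcoeff : Q.coeff n = ∑ c, k c * ∏ i, ⟪b, v c i⟫_ℝ := by
      have h := coeff_prod_of_natDegree_le S (fun e => C 1 * X + C (-root a e)) 1
        fun i _ => natDegree_linear_le
      rw [mul_one, hcard] at h
      rw [hQ, coeff_C_mul, h]
      simp
    have h0 : linePoly k v a b = Q := by
      refine eq_of_degree_sub_lt_of_eval_finset_eq (S.image (root a)) ?_ ?_
      · rw [Finset.card_image_of_injOn (hinj a ha), hcard, degree_lt_iff_coeff_zero]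
        intro m hm
        rcases hm.eq_or_lt with rfl | hm
        · rw [coeff_sub, coeff_linePoly, hQcoeff, sub_self]
        · rw [coeff_sub, coeff_eq_zero_of_natDegree_lt ((natDegree_linePoly_le k v a b).trans_lt hm),
            coeff_eq_zero_of_natDegree_lt (hQdeg.trans_lt hm), sub_self]
      · intro t ht
        obtain ⟨e, he, rfl⟩ := Finset.mem_image.1 ht
        rw [hzero a e he, hQ, eval_mul, eval_prod, Finset.prod_eq_zero he (by simp), mul_zero]
    rw [← heval0, h0, hQ, eval_mul, eval_C, eval_prod]
    simp [hroot]

end Polynomial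

/-! ### Consequences for the polynomial of the arrangement -/

section Vanishing

variable [FiniteDimensional ℝ V]

open Classical in
theorem pizzaPoly_eq_sum (E : Finset V) (a : V) :
    pizzaPoly E a = ∑ c : Quotient (evenSeqSetoid E (Module.finrank ℝ V)),
      (2 ^ Module.finrank ℝ V / (Nat.factorial (Module.finrank ℝ V) : ℝ) *
        chamberSign E (flagSign (unitNormal (Quotient.out c).1))) *
      ∏ i, ⟪a, unitNormal (Quotient.out c).1 i⟫_ℝ := by
  simp only [pizzaPoly, Finset.mul_sum, seqTerm_eq_flagTerm, flagTerm, mul_assoc]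

theorem pizzaPoly_eq_of_preserves {E S : Finset V} (hE : IsArrangement E) (hS : S ⊆ E)
    (hw : ∀ e ∈ S, Preserves (hyp e).reflection E) :
    (Module.finrank ℝ V + 1 ≤ S.card → ∀ a, pizzaPoly E a = 0) ∧
    (S.card = Module.finrank ℝ V → ∃ c : ℝ, ∀ a, pizzaPoly E a = c * ∏ e ∈ S, ⟪a, e⟫_ℝ) := by
  classical
  obtain ⟨b, hb⟩ := hE.exists_base
  have : CompleteSpace V := FiniteDimensional.complete ℝ V
  have hF := fun e he a ha => pizzaPoly_eq_zero_of_mem_hyp hE (hS he) (hw e he) (a := a) ha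
  simp only [pizzaPoly_eq_sum] at hF
  have h := sum_prod_inner_eq_of_vanishing (fun e he => hb e (hS he))
    (fun e he => hE.norm_eq_one e (hS he)) hF
  simp only [← pizzaPoly_eq_sum] at h
  refine ⟨h.1, fun hcard => ⟨pizzaPoly E b * (∏ e ∈ S, ⟪e, b⟫_ℝ)⁻¹, fun a => ?_⟩⟩
  rw [h.2 hcard, Finset.prod_div_distrib]
  ring

end Vanishing

/-! ### Pairwise orthogonal arrangements -/

section TypeA

variable {r : ℕ} {E : Finset V}

theorem IsEvenSeq.injective (hE : IsArrangement E) {e : Fin r → E} (he : IsEvenSeq e) :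
    Function.Injective e := by
  have key : ∀ i j : Fin r, i < j → e i ≠ e j := by
    intro i j hij h
    refine (he.succ_covBy hE j).ne ?_
    rw [seqSpace_succ, inf_eq_left, ← h]
    refine (seqSpace_antitone e (Nat.succ_le_of_lt hij)).trans ?_
    rw [Nat.succ_eq_add_one, seqSpace_succ]
    exact inf_le_right
  intro i j h
  rcases lt_trichotomy i j with h1 | h1 | h1
  · exact absurd h (key i j h1)
  · exact h1
  · exact absurd h.symm (key j i h1)

variable (hon : ∀ x ∈ E, ∀ y ∈ E, x ≠ y → ⟪x, y⟫_ℝ = 0)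
include hon

theorem mem_seqSpace_of_forall_ne {e : Fin r → E} {i : ℕ} {y : E}
    (hy : ∀ j : Fin r, (j : ℕ) < i → e j ≠ y) : (y : V) ∈ seqSpace e i :=
  mem_seqSpace.2 fun j hj => hon _ (e j).2 _ y.2 fun h => hy j hj (Subtype.ext h)

theorem exists_eq_of_seqSpace_inf_hyp_le (hE : IsArrangement E) {e : Fin r → E} {i : ℕ} {x y : E}
    (h : seqSpace e i ⊓ hyp (x : V) ≤ hyp (y : V)) :
    y = x ∨ ∃ j : Fin r, (j : ℕ) < i ∧ e j = y := by
  by_contra! hcon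
  have h1 : (y : V) ∈ hyp (y : V) := h ⟨mem_seqSpace_of_forall_ne hon hcon.2,
    mem_hyp.2 (hon _ x.2 _ y.2 fun h => hcon.1 (Subtype.ext h.symm))⟩
  exact hE.ne_zero y.2 (inner_self_eq_zero.1 (mem_hyp.1 h1))

theorem exists_eq_of_seqSpace_le (hE : IsArrangement E) {e : Fin r → E} {i : ℕ} {y : E}
    (h : seqSpace e i ≤ hyp (y : V)) : ∃ j : Fin r, (j : ℕ) < i ∧ e j = y := by
  by_contra! hcon
  have h1 : (y : V) ∈ hyp (y : V) := h (mem_seqSpace_of_forall_ne hon hcon)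
  exact hE.ne_zero y.2 (inner_self_eq_zero.1 (mem_hyp.1 h1))

/-- For an unused `y`, the only members containing the intersection of `seqSpace e (i + 1)` with
`H_y` are `seqSpace e (i + 1)` and `seqSpace e i ⊓ hyp y`. Two is even, so restriction never
discards a trace. -/
theorem mem_seqArr_iff_of_orthogonal (hE : IsArrangement E) {e : Fin r → E}
    (he : Function.Injective e) {i : ℕ} (hi : i ≤ r) (K : Submodule ℝ V) :
    K ∈ seqArr e i ↔
      ∃ y : E, (∀ j : Fin r, (j : ℕ) < i → e j ≠ y) ∧ K = seqSpace e i ⊓ hyp (y : V) := by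
  induction i generalizing K with
  | zero => simp [seqArr, hyperplanes, seqSpace_zero]
  | succ i ih =>
    have ih := ih (by omega)
    set k : Fin r := ⟨i, hi⟩ with hk
    have hM : seqSpace e (i + 1) = seqSpace e i ⊓ hyp (e k : V) := seqSpace_succ e k
    have hlt : ∀ y : E, (∀ j : Fin r, (j : ℕ) < i + 1 → e j ≠ y) ↔
        (∀ j : Fin r, (j : ℕ) < i → e j ≠ y) ∧ e k ≠ y := by
      intro y
      constructor
      · exact fun h => ⟨fun j hj => h j (by omega), h k (by simp [hk])⟩
      · rintro ⟨h1, h2⟩ j hj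
        rcases Nat.lt_succ_iff_lt_or_eq.1 hj with h | h
        · exact h1 j h
        · rwa [show j = k from Fin.ext h]
    constructor
    · rintro ⟨N, hN, hne, -, rfl⟩
      obtain ⟨y, hy, rfl⟩ := (ih N).1 hN
      refine ⟨y, (hlt y).2 ⟨hy, fun h => hne (by rw [hM, h])⟩, ?_⟩
      rw [← inf_assoc, inf_eq_left.2 (seqSpace_antitone e i.le_succ)]
    · rintro ⟨y, hy, rfl⟩
      have hy' := (hlt y).1 hy
      have hinf : seqSpace e (i + 1) ⊓ (seqSpace e i ⊓ hyp (y : V)) =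
          seqSpace e (i + 1) ⊓ hyp (y : V) := by
        rw [← inf_assoc, inf_eq_left.2 (seqSpace_antitone e i.le_succ)]
      have hne : seqSpace e i ⊓ hyp (y : V) ≠ seqSpace e (i + 1) := by
        intro h
        obtain ⟨j, hj, rfl⟩ := exists_eq_of_seqSpace_le hon hE (h ▸ inf_le_right)
        exact hy j hj rfl
      refine ⟨_, (ih _).2 ⟨y, hy'.1, rfl⟩, hne, ?_, hinf.symm⟩
      have hset : {K ∈ seqArr e i | seqSpace e (i + 1) ⊓ (seqSpace e i ⊓ hyp (y : V)) ≤ K} =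
          {seqSpace e i ⊓ hyp (y : V), seqSpace e (i + 1)} := by
        ext K
        simp only [Set.mem_ofPred_eq, Set.mem_insert_iff, Set.mem_singleton_iff, ih]
        constructor
        · rintro ⟨⟨z, hz, rfl⟩, hle⟩
          rw [hinf] at hle
          rcases exists_eq_of_seqSpace_inf_hyp_le hon hE (hle.trans inf_le_right) with
            rfl | ⟨j, hj, rfl⟩
          · exact Or.inl rfl
          · right
            rcases Nat.lt_succ_iff_lt_or_eq.1 hj with h | h
            · exact absurd rfl (hz j h)
            · rw [hM, show j = k from Fin.ext h]
        · rintro (rfl | rfl)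
          · exact ⟨⟨y, hy'.1, rfl⟩, inf_le_right⟩
          · refine ⟨⟨e k, fun j hj h => ?_, hM⟩, inf_le_left⟩
            have := congrArg Fin.val (he h)
            simp only [hk] at this
            omega
      rw [hset, Set.ncard_pair hne]
      exact even_two

theorem isEvenSeq_of_orthogonal (hE : IsArrangement E) {e : Fin r → E}
    (he : Function.Injective e) : IsEvenSeq e := by
  intro i
  rw [mem_seqArr_iff_of_orthogonal hon hE he i.2.le]
  refine ⟨e i, fun j hj h => ?_, seqSpace_succ e i⟩
  rw [he h] at hj
  exact lt_irrefl _ hj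

theorem eq_of_seqSpace_eq (hE : IsArrangement E) {e f : Fin r → E}
    (hf : Function.Injective f) (h : ∀ i ≤ r, seqSpace e i = seqSpace f i) : e = f := by
  funext i
  have h1 : seqSpace e (i + 1) ≤ hyp (f i : V) := by
    rw [h _ i.2, seqSpace_succ]
    exact inf_le_right
  obtain ⟨j, hj, hji⟩ := exists_eq_of_seqSpace_le hon hE h1
  rcases Nat.lt_succ_iff_lt_or_eq.1 hj with h2 | h2
  · have h3 : seqSpace f i ≤ hyp (f i : V) := by
      rw [← h _ i.2.le, ← hji]
      refine (seqSpace_antitone e (Nat.succ_le_of_lt h2)).trans ?_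
      rw [Nat.succ_eq_add_one, seqSpace_succ]
      exact inf_le_right
    obtain ⟨l, hl, hli⟩ := exists_eq_of_seqSpace_le hon hE h3
    rw [hf hli] at hl
    exact absurd hl (lt_irrefl _)
  · rwa [show j = i from Fin.ext h2] at hji

/-- Every injective sequence is even and is determined by its flag, so the classes are the orderings
of `E`. -/
theorem card_quotient_of_orthogonal (hE : IsArrangement E) (hcard : E.card = r)
    [Fintype (Quotient (evenSeqSetoid E r))] :
    Fintype.card (Quotient (evenSeqSetoid E r)) = Nat.factorial r := by
  let g : (Fin r ↪ E) → Quotient (evenSeqSetoid E r) := fun e =>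
    ⟦⟨e, isEvenSeq_of_orthogonal hon hE e.injective⟩⟧
  have hg : Function.Bijective g := by
    constructor
    · intro e f h
      exact DFunLike.coe_injective (eq_of_seqSpace_eq hon hE f.injective (Quotient.exact h))
    · intro c
      induction c using Quotient.inductionOn with
      | h e => exact ⟨⟨e.1, e.2.injective hE⟩, rfl⟩
  rw [← Fintype.card_of_bijective hg, Fintype.card_embedding_eq, Fintype.card_fin,
    Fintype.card_coe, hcard, Nat.descFactorial_self]

variable [FiniteDimensional ℝ V]

/-- Each `e i` already lies in the preceding space, so the unit normals are the entries themselves.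
No member of `E` is negative on them, so the sign is one. -/
theorem seqTerm_eq_prod_of_orthogonal (hE : IsArrangement E) (hcard : E.card = r)
    {e : Fin r → E} (he : Function.Injective e) (a : V) : seqTerm e a = ∏ x ∈ E, ⟪a, x⟫_ℝ := by
  have hnu : unitNormal e = fun i => (e i : V) := by
    funext i
    have hmem : (e i : V) ∈ seqSpace e i := by
      refine mem_seqSpace_of_forall_ne hon fun j hj h => ?_
      rw [he h] at hj
      exact lt_irrefl _ hj
    rw [unitNormal, Submodule.starProjection_eq_self_iff.2 hmem, hE.norm_eq_one _ (e i).2, inv_one,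
      one_smul]
  have hsign : chamberSign E (flagSign (unitNormal e)) = 1 := by
    rw [chamberSign_eq_prod, hnu]
    refine Finset.prod_eq_one fun x hx => if_neg (flagSign_ne_neg_one fun i => ?_)
    by_cases h : x = e i
    · rw [h]
      exact real_inner_self_nonneg
    · rw [hon x hx _ (e i).2 h]
  have hbij : Function.Bijective e :=
    (Fintype.bijective_iff_injective_and_card e).2 ⟨he, by simp [hcard]⟩
  rw [seqTerm_eq_flagTerm, flagTerm, hsign, one_mul, hnu, ← Finset.prod_coe_sort E]
  exact (Equiv.ofBijective e hbij).prod_comp fun x : E => ⟪a, (x : V)⟫_ℝ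

theorem pizzaPoly_of_orthogonal (hE : IsArrangement E) (hcard : E.card = Module.finrank ℝ V)
    (a : V) : pizzaPoly E a = 2 ^ Module.finrank ℝ V * ∏ e ∈ E, ⟪a, e⟫_ℝ := by
  classical
  unfold pizzaPoly
  rw [Finset.sum_congr rfl fun c _ => seqTerm_eq_prod_of_orthogonal hon hE hcard
    ((Quotient.out c).2.injective hE) a, Finset.sum_const, Finset.card_univ,
    card_quotient_of_orthogonal hon hE hcard, nsmul_eq_mul, ← mul_assoc,
    div_mul_cancel₀ _ (Nat.cast_ne_zero.2 (Nat.factorial_ne_zero _))]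

end TypeA

/-! ### Recognising type `A_1^n` -/

section Classification

variable {E : Finset V}

theorem IsTypeA1.card_eq (h : IsTypeA1 E) : E.card = Module.finrank ℝ V := by
  obtain ⟨b, hb⟩ := h
  rw [← Set.ncard_coe_finset, hb, ← Set.image_univ,
    Set.ncard_image_of_injective _ b.orthonormal.linearIndependent.injective, Set.ncard_univ,
    Nat.card_eq_fintype_card, Fintype.card_fin]

theorem IsTypeA1.inner_eq_zero (h : IsTypeA1 E) : ∀ x ∈ E, ∀ y ∈ E, x ≠ y → ⟪x, y⟫_ℝ = 0 := by
  obtain ⟨b, hb⟩ := h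
  intro x hx y hy hne
  rw [← Finset.mem_coe, hb] at hx hy
  obtain ⟨i, rfl⟩ := hx
  obtain ⟨j, rfl⟩ := hy
  exact b.orthonormal.2 fun hij => hne (by rw [hij])

theorem IsEven.sInf_hyperplanes_eq_bot (h : IsEven E) : sInf (hyperplanes E) = ⊥ := by
  have := h 0 Fin.elim0 fun i => i.elim0
  rwa [seqSpace_zero, top_inf_eq] at this

/-- Essentiality for the empty sequence says that only zero is orthogonal to all of `E`. -/
theorem IsEven.span_eq_top (h : IsEven E) : Submodule.span ℝ (E : Set V) = ⊤ := by
  rw [← Submodule.orthogonal_eq_bot_iff, eq_bot_iff, ← h.sInf_hyperplanes_eq_bot]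
  refine le_sInf ?_
  rintro _ ⟨e, he, rfl⟩
  exact Submodule.orthogonal_le ((Submodule.span_singleton_le_iff_mem _ _).2
    (Submodule.subset_span he))

theorem IsEven.finrank_le_card (h : IsEven E) : Module.finrank ℝ V ≤ E.card := by
  rw [← finrank_top ℝ V, ← h.span_eq_top]
  exact finrank_span_finset_le_card E

variable [FiniteDimensional ℝ V]

theorem reflection_hyp_apply {x : V} (hx : ‖x‖ = 1) (y : V) :
    (hyp x).reflection y = y - (2 * ⟪x, y⟫_ℝ) • x := by
  have h := Submodule.reflection_orthogonal_apply (K := ℝ ∙ x) y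
  rw [Submodule.reflection_singleton_apply] at h
  simp only [hx] at h
  refine h.trans ?_
  simp [two_smul, two_mul, add_smul]

theorem isTypeA1_of_card_eq (hE : IsArrangement E) (heven : IsEven E)
    (hw : ∀ e ∈ E, Preserves (hyp e).reflection E) (hcard : E.card = Module.finrank ℝ V) :
    IsTypeA1 E := by
  classical
  have hspan : ⊤ ≤ Submodule.span ℝ (Set.range ((↑) : E → V)) := by
    simp [heven.span_eq_top]
  have hli : LinearIndependent ℝ ((↑) : E → V) :=
    linearIndependent_of_top_le_span_of_card_eq_finrank hspan (by simp [hcard])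
  let b := Module.Basis.mk hli hspan
  have hb : ∀ x : E, b x = x := fun x => by simp [b]
  have hon : ∀ x y : E, x ≠ y → ⟪(x : V), y⟫_ℝ = 0 := by
    intro x y hxy
    obtain ⟨z, hz⟩ := (hw x x.2).exists_hyp_eq y
    rw [mapIso_hyp] at hz
    have hx1 := hE.norm_eq_one _ x.2
    have hs := reflection_hyp_apply hx1 (y : V)
    -- `E` is a basis, and the reflection in `H_x` changes `y` only by a multiple of `x`, so the
    -- coordinate at `y` remains `1`. But the image is a member of `E` up to sign, so it can only be
    -- `y`, which forces `(x, y) = 0`.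
    have hcoord : b.repr ((hyp (x : V)).reflection y) y = 1 := by
      rw [hs, ← hb x, ← hb y]
      simp [hxy]
    have hcases := eq_or_eq_neg_of_hyp_eq (hE.norm_eq_one _ z.2)
      (((hyp (x : V)).reflection.norm_map _).trans (hE.norm_eq_one _ y.2)) hz
    have hzy : (hyp (x : V)).reflection y = z := by
      rcases hcases with h | h
      · exact h.symm
      -- The coordinate of `-z` at `y` is `0` or `-1`, never `1`.
      · rw [eq_neg_iff_add_eq_zero, ← neg_eq_iff_add_eq_zero] at h
        rw [← h, ← hb z, map_neg, b.repr_self, Finsupp.neg_apply, Finsupp.single_apply] at hcoord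
        split_ifs at hcoord <;> norm_num at hcoord
    have : z = y := by
      by_contra hne
      rw [hzy, ← hb z, b.repr_self, Finsupp.single_apply, if_neg hne] at hcoord
      exact zero_ne_one hcoord
    rw [hzy, this] at hs
    have h2 : (2 * ⟪(x : V), y⟫_ℝ) • (x : V) = 0 := by
      rw [eq_sub_iff_add_eq] at hs
      simpa using hs
    simpa [hE.ne_zero x.2] using h2
  have hfin : Fintype.card E = Module.finrank ℝ V := by simp [hcard]
  let o : OrthonormalBasis E ℝ V := OrthonormalBasis.mk
    ⟨fun x => hE.norm_eq_one _ x.2, fun x y h => hon x y h⟩ hspan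
  refine ⟨o.reindex (Fintype.equivFinOfCardEq hfin), ?_⟩
  have ho : ∀ x : E, o x = x := fun x => congrFun (OrthonormalBasis.coe_mk _ _) x
  ext x
  simp [ho]

end Classification

end

end PizzaArrangement

theorem proposition5p6 {V : Type*} [NormedAddCommGroup V] [InnerProductSpace ℝ V]
    [FiniteDimensional ℝ V] (E : Finset V) (hE : PizzaArrangement.IsArrangement E)
    (heven : PizzaArrangement.IsEven E) :
    (PizzaArrangement.IsCoxeter E →
      (PizzaArrangement.IsTypeA1 E → ∀ a : V,
        PizzaArrangement.pizzaPoly E a =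
          2 ^ Module.finrank ℝ V * ∏ e ∈ E, inner ℝ a e) ∧
      (¬ PizzaArrangement.IsTypeA1 E → ∀ a : V, PizzaArrangement.pizzaPoly E a = 0)) ∧
    (∀ E' : Finset V, E' ⊆ E → PizzaArrangement.IsCoxeter E' →
      (∀ w ∈ PizzaArrangement.coxeterGroup E', PizzaArrangement.Preserves w E) →
      (Module.finrank ℝ V + 1 ≤ E'.card → ∀ a : V, PizzaArrangement.pizzaPoly E a = 0) ∧
      (E'.card = Module.finrank ℝ V → ∃ c : ℝ, ∀ a : V,
        PizzaArrangement.pizzaPoly E a = c * ∏ e ∈ E', inner ℝ a e)) := by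
  refine ⟨fun hC => ?_, fun E' hE' _ hw => ?_⟩
  · have hw : ∀ e ∈ E, PizzaArrangement.Preserves (PizzaArrangement.hyp e).reflection E :=
      fun e he => hC.reflection_preserves _ ⟨e, he, rfl⟩
    refine ⟨fun hA => PizzaArrangement.pizzaPoly_of_orthogonal hA.inner_eq_zero hE hA.card_eq,
      fun hA => (PizzaArrangement.pizzaPoly_eq_of_preserves hE subset_rfl hw).1 ?_⟩
    exact Nat.succ_le_of_lt (heven.finrank_le_card.lt_of_ne fun h =>
      hA (PizzaArrangement.isTypeA1_of_card_eq hE heven hw h.symm))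
  · exact PizzaArrangement.pizzaPoly_eq_of_preserves hE hE' fun e he =>
      hw _ (Subgroup.subset_closure ⟨_, ⟨e, he, rfl⟩, rfl⟩)
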